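/- Let $G$ be a compact Hausdorff topological group and $\varphi:G\to G$ a group endomorphism (continuity of $\varphi$ is not needed). The Reidemeister classes of $\varphi$ are the sets $\{xg\varphi(x^{-1}) : x\in G\}$, $g\in G$; their number is $R(\varphi)$; a $\varphi$-class function is a function $f:G\to\mathbb C$ that is constant on every Reidemeister class. A matrix coefficient of a representation $\rho$ of $G$ on a complex vector space $V$ is a function $g\mapsto \ell(\rho(g))$, where $\ell$ is a linear functional on the space of linear endomorphisms of $V$. (1) Let $\rho$ be a continuous irreducible representation of $G$ on a finite-dimensional complex vector space. Then $\rho\sim\rho\circ\varphi$ if and only if some nonzero $\varphi$-class function is a matrix coefficient of $\rho$. (2) If $\rho\sim\rho\circ\varphi$ in (1), then the function there is unique up to scaling, and the nonzero $\varphi$-class functions which are matrix coefficients of $\rho$ are exactly the functions $$T_{S,\rho}: g\mapsto \operatorname{Tr}(S\circ\rho(g)),$$ where $S\neq 0$ is an intertwining operator from $\rho$ to $\rho\circ\varphi$, i.e. $\rho(\varphi(x))S=S\rho(x)$ for all $x\in G$. (3) Let $\widehat G$ be the set of unitary equivalence classes of irreducible (strongly continuous) unitary representations of $G$ on nonzero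 complex Hilbert spaces, let $F$ be the set of all $[\rho]\in\widehat G$ with $\rho\sim\rho\circ\varphi$, and let $RT(\varphi)\in\{0,1,2,\dots,\infty\}$ be the number of elements of $F$. One says that TBFT (the twisted Burnside–Frobenius theorem) is true for $\varphi$ if $R(\varphi)=RT(\varphi)$ whenever at least one of these numbers is finite. For every $[\rho]\in F$ there is a nonzero $\varphi$-class function $T_{[\rho]}$ that is a matrix coefficient of $\rho$. For every choice of such functions, the family $(T_{[\rho]})_{[\rho]\in F}$ is a (linear) basis of the space of all $\varphi$-class functions if and only if at least one of $R(\varphi)$, $RT(\varphi)$ is finite and TBFT is true for $\varphi$. In particular, if one of these numbers is finite, TBFT is true for $\varphi$ if and only if these functions form a basis of the space of $\varphi$-class functions. -/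

import Mathlib

universe u v w

noncomputable section

namespace Reidemeister

section Classes

variable {G : Type u} [Group G]

/-- Twisted conjugacy: `g ∼ x g φ(x⁻¹)`. -/
def twistedConj (φ : G →* G) : Setoid G where
  r g h := ∃ x : G, h = x * g * φ x⁻¹
  iseqv :=
    { refl := fun g => ⟨1, by simp⟩
      symm := by
        rintro g h ⟨x, rfl⟩
        exact ⟨x⁻¹, by simp [mul_assoc]⟩
      trans := by
        rintro g h k ⟨x, rfl⟩ ⟨y, rfl⟩
        exact ⟨y * x, by simp [mul_assoc]⟩ }

/-- The Reidemeister number `R(φ)`: the number of twisted conjugacy classes. -/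
def reidemeisterNumber (φ : G →* G) : ℕ∞ :=
  ENat.card (Quotient (twistedConj φ))

/-- The space of `φ`-class functions: functions that are constant on Reidemeister classes. -/
def classFunctions (φ : G →* G) : Submodule ℂ (G → ℂ) where
  carrier := {f | ∀ g h : G, (twistedConj φ).r g h → f g = f h}
  add_mem' := by
    intro a b ha hb g h r
    simp only [Pi.add_apply, ha g h r, hb g h r]
  zero_mem' := fun _ _ _ => rfl
  smul_mem' := by
    intro c a ha g h r
    simp only [Pi.smul_apply, ha g h r]

/-- A matrix coefficient of `ρ`: a function `g ↦ ℓ (ρ g)` with `ℓ` a linear functional on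
the space of endomorphisms of `V`. -/
def IsMatrixCoefficient {V : Type w} [AddCommGroup V] [Module ℂ V]
    (ρ : Representation ℂ G V) (f : G → ℂ) : Prop :=
  ∃ ℓ : Module.Dual ℂ (V →ₗ[ℂ] V), ∀ g : G, f g = ℓ (ρ g)

/-- The representation `ρ ∘ φ`. -/
def twist {V : Type w} [AddCommGroup V] [Module ℂ V]
    (ρ : Representation ℂ G V) (φ : G →* G) : Representation ℂ G V :=
  MonoidHom.comp ρ φ

/-- The function `g ↦ Tr (S ∘ ρ g)`. -/
def traceFunction {V : Type w} [AddCommGroup V] [Module ℂ V]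
    (ρ : Representation ℂ G V) (S : V →ₗ[ℂ] V) : G → ℂ :=
  fun g => LinearMap.trace ℂ V (S ∘ₗ ρ g)

end Classes

section Dual

variable (G : Type u) [Group G] [TopologicalSpace G]

/-- An irreducible (strongly continuous) unitary representation of `G` on a nonzero complex
Hilbert space, of any dimension. -/
structure UnitaryIrrep where
  /-- the Hilbert space -/
  space : Type v
  [normed : NormedAddCommGroup space]
  [hilbert : InnerProductSpace ℂ space]
  [complete : CompleteSpace space]
  /-- the action by unitary operators -/
  action : G →* (space ≃ₗᵢ[ℂ] space)
  continuous_action : ∀ x : space, Continuous fun g => action g x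
  nontrivial : Nontrivial space
  irreducible : ∀ K : Submodule ℂ space, IsClosed (K : Set space) →
    (∀ g : G, ∀ x ∈ K, action g x ∈ K) → K = ⊥ ∨ K = ⊤

attribute [instance] UnitaryIrrep.normed UnitaryIrrep.hilbert UnitaryIrrep.complete

variable {G}

/-- The underlying linear representation. -/
def UnitaryIrrep.toRepresentation (π : UnitaryIrrep.{u, v} G) :
    Representation ℂ G π.space where
  toFun g := (π.action g).toLinearEquiv.toLinearMap
  map_one' := by ext x; simp
  map_mul' g h := by ext x; simp

variable (G)

/-- Unitary equivalence. -/
def unitaryEquivalence : Setoid (UnitaryIrrep.{u, v} G) where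
  r π σ := ∃ U : π.space ≃ₗᵢ[ℂ] σ.space, ∀ (g : G) (x : π.space),
    U (π.action g x) = σ.action g (U x)
  iseqv :=
    { refl := fun π => ⟨LinearIsometryEquiv.refl ℂ π.space, fun _ _ => rfl⟩
      symm := by
        rintro π σ ⟨U, hU⟩
        refine ⟨U.symm, fun g x => U.injective ?_⟩
        rw [hU]
        simp
      trans := by
        rintro π σ τ ⟨U, hU⟩ ⟨W, hW⟩
        exact ⟨U.trans W, fun g x => by simp [hU, hW]⟩ }

/-- The unitary dual of `G`. -/
def UnitaryDual : Type (max u (v + 1)) :=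
  Quotient (unitaryEquivalence.{u, v} G)

variable {G}

/-- The class `[π]` in the unitary dual. -/
def UnitaryIrrep.toDual (π : UnitaryIrrep.{u, v} G) : UnitaryDual.{u, v} G :=
  Quotient.mk (unitaryEquivalence.{u, v} G) π

/-- `π` is unitarily equivalent to `π ∘ φ` (which itself may be reducible in general). -/
def UnitaryIrrep.IsFixed (π : UnitaryIrrep.{u, v} G) (φ : G →* G) : Prop :=
  ∃ U : π.space ≃ₗᵢ[ℂ] π.space, ∀ (g : G) (x : π.space),
    U (π.action g x) = π.action (φ g) (U x)

/-- The property `π ∼ π ∘ φ` depends only on the class of `π`. -/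
theorem UnitaryIrrep.IsFixed.of_toDual_eq {π σ : UnitaryIrrep.{u, v} G} {φ : G →* G}
    (h : π.IsFixed φ) (e : π.toDual = σ.toDual) : σ.IsFixed φ := by
  obtain ⟨U, hU⟩ := h
  obtain ⟨W, hW⟩ := Quotient.exact e
  refine ⟨(W.symm.trans U).trans W, fun g x => ?_⟩
  have h1 : W.symm (σ.action g x) = π.action g (W.symm x) := by
    apply W.injective
    rw [hW]
    simp
  simp [h1, hU, hW]

/-- The points `[π]` of the unitary dual with `π ∼ π ∘ φ`. -/
def FixedPoint (φ : G →* G) : Type (max u (v + 1)) :=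
  {p : UnitaryDual.{u, v} G // ∃ π : UnitaryIrrep.{u, v} G, π.toDual = p ∧ π.IsFixed φ}

/-- The number of classes of irreducible unitary representations with `π ∼ π ∘ φ`. -/
def fixedPointNumber (φ : G →* G) : ℕ∞ :=
  ENat.card (FixedPoint.{u, v} φ)

/-- The twisted Burnside–Frobenius theorem is true for `φ`: the Reidemeister number equals the
number of fixed irreducible unitary representations, if one of these numbers is finite. -/
def TBFT (φ : G →* G) : Prop :=
  (reidemeisterNumber φ < ⊤ ∨ fixedPointNumber.{u, v} φ < ⊤) →
    reidemeisterNumber φ = fixedPointNumber.{u, v} φ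

/-- `T` picks for every fixed point `[π]` a nonzero `φ`-class function that is a matrix
coefficient of (a representative of) `[π]`. -/
def IsCoefficientSystem (φ : G →* G) (T : FixedPoint.{u, v} φ → G → ℂ) : Prop :=
  ∀ p : FixedPoint.{u, v} φ, T p ≠ 0 ∧ T p ∈ classFunctions φ ∧
    ∃ π : UnitaryIrrep.{u, v} G, π.toDual = p.1 ∧ IsMatrixCoefficient π.toRepresentation (T p)

end Dual

end Reidemeister

end

/-! By nondegeneracy of the trace form, every functional on `End V` is `A ↦ Tr (S A)` for a unique
`S`. Burnside's theorem says that for irreducible `ρ` the `ρ g` span `End V`, so the coefficient `g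
↦ Tr (S ρ g)` determines `S`. Cyclicity of the trace turns invariance under twisted conjugacy into
`ρ (φ x) S = S ρ x`, and Schur's lemma settles existence and uniqueness.

Coefficients of inequivalent irreducibles are independent by the density theorem
(`linearIndependent_of_isMatrixCoefficient`), and irreducible unitary representations of a compact
group are finite-dimensional, so a coefficient system is always independent. If it spans, all class
functions are continuous, which by compactness forces `R(φ)` to be finite
(`finite_quotient_of_continuous`). What remains is a dimension count: the class functions have
dimension `R(φ)`, the span has dimension `RT(φ)`. -/

section

open scoped MonoidAlgebra

namespace Representation

/-! ### Density and Burnside theorems -/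

section Density

variable {G : Type u} [Group G] {ι : Type*}
  {V : ι → Type w} [∀ i, AddCommGroup (V i)] [∀ i, Module ℂ (V i)]
  [∀ i, FiniteDimensional ℂ (V i)]

/-- Every endomorphism of a finite product of pairwise inequivalent irreducible
finite-dimensional representations acts on every factor by a scalar. -/
theorem exists_end_pi_asModule_eq_smul [Finite ι] (ρ : ∀ i, Representation ℂ G (V i))
    (hirr : ∀ i, (ρ i).IsIrreducible)
    (hne : Pairwise fun i j => IsEmpty ((ρ i).Equiv (ρ j)))
    (e : Module.End ℂ[G] (∀ i, (ρ i).asModule)) :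
    ∃ c : ι → ℂ, ∀ x i, e x i = c i • x i := by
  classical
  have := Fintype.ofFinite ι
  have hoff : ∀ i j, j ≠ i →
      (LinearMap.proj i ∘ₗ e ∘ₗ LinearMap.single ℂ[G] (fun i => (ρ i).asModule) j) = 0 := by
    intro i j hij
    have := hirr i
    have := hirr j
    have := hne hij
    exact (IntertwiningMap.equivLinearMapAsModule (ρ j) (ρ i)).symm.injective
      (Subsingleton.elim _ _)
  have hdiag : ∀ i, ∃ c : ℂ, ∀ y : (ρ i).asModule, e (Pi.single i y) i = c • y := by
    intro i
    have := hirr i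
    obtain ⟨c, hc⟩ := (IsSimpleModule.algebraMap_end_bijective_of_isAlgClosed (A := ℂ[G])
      (V := (ρ i).asModule) ℂ).2
      (LinearMap.proj i ∘ₗ e ∘ₗ LinearMap.single ℂ[G] (fun i => (ρ i).asModule) i)
    exact ⟨c, fun y => (congrArg (fun f => f y) hc).symm⟩
  choose c hc using hdiag
  refine ⟨c, fun x i => ?_⟩
  conv_lhs => rw [← Finset.univ_sum_single x]
  rw [map_sum, Finset.sum_apply, Finset.sum_eq_single i, hc]
  · intro j _ hji
    exact congrArg (fun f => f (x j)) (hoff i j hji)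
  · simp

/-- The density theorem for a finite family of pairwise inequivalent irreducible
finite-dimensional representations. -/
theorem exists_asAlgebraHom_eq [Finite ι] (ρ : ∀ i, Representation ℂ G (V i))
    (hirr : ∀ i, (ρ i).IsIrreducible)
    (hne : Pairwise fun i j => IsEmpty ((ρ i).Equiv (ρ j)))
    (A : ∀ i, Module.End ℂ (V i)) :
    ∃ r : ℂ[G], ∀ i, (ρ i).asAlgebraHom r = A i := by
  classical
  have := Fintype.ofFinite ι
  have := hirr
  let M := ∀ i, (ρ i).asModule
  -- The product of the `A i` commutes with all module endomorphisms, since these are scalar on each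
  -- factor; Jacobson density then matches it with some `r` on a basis.
  let f : Module.End (Module.End ℂ[G] M) M :=
    { toFun := fun x i => (ρ i).asModuleEquiv.symm (A i ((ρ i).asModuleEquiv (x i)))
      map_add' := fun x y => by
        funext i
        change (ρ i).asModuleEquiv.symm (A i ((ρ i).asModuleEquiv (x i + y i))) = _
        rw [map_add, map_add, map_add]
        rfl
      map_smul' := fun e x => by
        obtain ⟨c, hc⟩ := exists_end_pi_asModule_eq_smul ρ hirr hne e
        funext i
        change (ρ i).asModuleEquiv.symm (A i ((ρ i).asModuleEquiv (e x i))) = e _ i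
        rw [hc, hc, map_smul, map_smul, map_smul] }
  let b := fun i => Module.finBasis ℂ (V i)
  obtain ⟨r, hr⟩ := jacobson_density f (Finset.univ.image fun p : Σ i, Fin (Module.finrank ℂ (V i)) =>
    (Pi.single p.1 ((ρ p.1).asModuleEquiv.symm (b p.1 p.2)) : M))
  refine ⟨r, fun i => (b i).ext fun k => ?_⟩
  have h := congrFun (hr (Pi.single i ((ρ i).asModuleEquiv.symm (b i k)))
    (Finset.mem_image.2 ⟨⟨i, k⟩, Finset.mem_univ _, rfl⟩)) i
  rw [Pi.smul_apply, Pi.single_eq_same] at h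
  have h' := congrArg (ρ i).asModuleEquiv h
  rw [asModuleEquiv_map_smul, LinearEquiv.apply_symm_apply] at h'
  rw [← h']
  change (ρ i).asModuleEquiv ((ρ i).asModuleEquiv.symm (A i ((ρ i).asModuleEquiv _))) = _
  simp

end Density

section Single

variable {G : Type u} [Group G] {V : Type w} [AddCommGroup V] [Module ℂ V]
  [FiniteDimensional ℂ V]

/-- **Burnside's theorem**: linear functionals on the endomorphisms of an irreducible
representation are determined by their values on the group. -/
theorem IsIrreducible.dual_end_ext {ρ : Representation ℂ G V} (hρ : ρ.IsIrreducible)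
    {l l' : Module.Dual ℂ (V →ₗ[ℂ] V)} (h : ∀ g, l (ρ g) = l' (ρ g)) : l = l' := by
  ext A
  obtain ⟨r, hr⟩ := exists_asAlgebraHom_eq (ι := Unit) (fun _ => ρ) (fun _ => hρ)
    (fun i j hij => (hij (Subsingleton.elim i j)).elim) (fun _ => A)
  have key : l ∘ₗ ρ.asAlgebraHom.toLinearMap = l' ∘ₗ ρ.asAlgebraHom.toLinearMap := by
    apply MonoidAlgebra.lhom_ext'
    intro g
    ext
    simp [h]
  have := congrArg (fun f => f r) key
  simpa [hr ()] using this

/-- Testing on the rank one operator `f ⊗ x` gives `f (S x) = 0`. -/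
theorem _root_.LinearMap.eq_zero_of_forall_trace_comp_eq_zero {S : V →ₗ[ℂ] V}
    (h : ∀ A : V →ₗ[ℂ] V, LinearMap.trace ℂ V (S ∘ₗ A) = 0) : S = 0 := by
  ext x
  rw [LinearMap.zero_apply, ← Module.forall_dual_apply_eq_zero_iff ℂ]
  intro f
  have hc : S ∘ₗ f.smulRight x = f.smulRight (S x) := by ext; simp
  rw [← LinearMap.trace_smulRight, ← hc, h]

theorem _root_.LinearMap.exists_eq_trace_comp (l : Module.Dual ℂ (V →ₗ[ℂ] V)) :
    ∃ S : V →ₗ[ℂ] V, ∀ A, l A = LinearMap.trace ℂ V (S ∘ₗ A) := by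
  let τ : (V →ₗ[ℂ] V) →ₗ[ℂ] Module.Dual ℂ (V →ₗ[ℂ] V) :=
    (LinearMap.mul ℂ (Module.End ℂ V)).compr₂ (LinearMap.trace ℂ V)
  have hinj : Function.Injective τ := by
    rw [← LinearMap.ker_eq_bot, LinearMap.ker_eq_bot']
    exact fun S hS => LinearMap.eq_zero_of_forall_trace_comp_eq_zero
      fun A => congrArg (fun f => f A) hS
  obtain ⟨S, hS⟩ := (LinearMap.injective_iff_surjective_of_finrank_eq_finrank
    (Subspace.dual_finrank_eq).symm).1 hinj l
  exact ⟨S, fun A => by rw [← hS]; rfl⟩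

theorem IsIrreducible.eq_of_traceFunction_eq {ρ : Representation ℂ G V} (hρ : ρ.IsIrreducible)
    {S S' : V →ₗ[ℂ] V}
    (h : Reidemeister.traceFunction ρ S = Reidemeister.traceFunction ρ S') : S = S' := by
  refine sub_eq_zero.1 (LinearMap.eq_zero_of_forall_trace_comp_eq_zero fun A => ?_)
  have key := hρ.dual_end_ext (l := LinearMap.trace ℂ V ∘ₗ LinearMap.mulLeft ℂ S)
    (l' := LinearMap.trace ℂ V ∘ₗ LinearMap.mulLeft ℂ S') fun g => congrFun h g
  rw [LinearMap.sub_comp, map_sub, sub_eq_zero]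
  exact congrArg (fun f => f A) key

end Single

end Representation

end

section

open Representation

namespace Reidemeister

/-! ### Class functions as traces of intertwining operators -/

section SingleRepresentation

variable {G : Type u} [Group G] {V : Type w} [AddCommGroup V] [Module ℂ V]

theorem isMatrixCoefficient_traceFunction (ρ : Representation ℂ G V) (S : V →ₗ[ℂ] V) :
    IsMatrixCoefficient ρ (traceFunction ρ S) :=
  ⟨LinearMap.trace ℂ V ∘ₗ LinearMap.mulLeft ℂ S, fun _ => rfl⟩

theorem traceFunction_mem_classFunctions {φ : G →* G} {ρ : Representation ℂ G V}
    (S : IntertwiningMap ρ (twist ρ φ)) :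
    traceFunction ρ S.toLinearMap ∈ classFunctions φ := by
  rintro g _ ⟨x, rfl⟩
  have hS : S.toLinearMap * ρ x = ρ (φ x) * S.toLinearMap := S.isIntertwining' x
  change LinearMap.trace ℂ V (S.toLinearMap * ρ g) =
    LinearMap.trace ℂ V (S.toLinearMap * ρ (x * g * φ x⁻¹))
  rw [map_mul ρ, map_mul ρ, ← mul_assoc, ← mul_assoc, hS, LinearMap.trace_mul_comm _ _ (ρ (φ x⁻¹)),
    ← mul_assoc, ← mul_assoc, ← map_mul ρ, ← map_mul φ, inv_mul_cancel, map_one, map_one, one_mul]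

theorem ne_zero_of_equiv_twist {φ : G →* G} {ρ : Representation ℂ G V}
    (hρ : ρ.IsIrreducible) (e : ρ.Equiv (twist ρ φ)) : e.toIntertwiningMap ≠ 0 := by
  intro h
  have hV : Subsingleton V := ⟨fun x y => e.toLinearEquiv.injective (by
    rw [Equiv.toLinearEquiv_apply, Equiv.toLinearEquiv_apply, h]; rfl)⟩
  have := IsSimpleModule.nontrivial (MonoidAlgebra ℂ G) ρ.asModule
  exact not_subsingleton ρ.asModule hV

variable [FiniteDimensional ℂ V]

theorem IsMatrixCoefficient.exists_eq_traceFunction {ρ : Representation ℂ G V} {f : G → ℂ}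
    (hf : IsMatrixCoefficient ρ f) : ∃ S : V →ₗ[ℂ] V, f = traceFunction ρ S := by
  obtain ⟨l, hl⟩ := hf
  obtain ⟨S, hS⟩ := LinearMap.exists_eq_trace_comp l
  exact ⟨S, funext fun g => by rw [hl, hS]; rfl⟩

theorem IsMatrixCoefficient.exists_intertwiningMap {φ : G →* G} {ρ : Representation ℂ G V}
    (hρ : ρ.IsIrreducible) {f : G → ℂ} (hf : IsMatrixCoefficient ρ f)
    (hc : f ∈ classFunctions φ) :
    ∃ S : IntertwiningMap ρ (twist ρ φ), f = traceFunction ρ S.toLinearMap := by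
  obtain ⟨S, rfl⟩ := hf.exists_eq_traceFunction
  refine ⟨⟨S, fun x => ?_⟩, rfl⟩
  -- Both operators have the same trace function, by cyclicity and invariance of `f`, so Burnside's
  -- theorem identifies them.
  have key : (ρ (φ x⁻¹) * S * ρ x : Module.End ℂ V) = S := by
    refine hρ.eq_of_traceFunction_eq (funext fun g => ?_)
    rw [hc g _ ⟨x, rfl⟩]
    change LinearMap.trace ℂ V (ρ (φ x⁻¹) * S * ρ x * ρ g) =
      LinearMap.trace ℂ V (S * ρ (x * g * φ x⁻¹))
    rw [mul_assoc, mul_assoc, LinearMap.trace_mul_comm, map_mul ρ, map_mul ρ]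
    simp only [mul_assoc]
  change S * ρ x = ρ (φ x) * S
  conv_rhs => rw [← key]
  rw [← mul_assoc, ← mul_assoc, ← map_mul ρ, ← map_mul φ, mul_inv_cancel, map_one, map_one,
    one_mul]

theorem traceFunction_ne_zero {φ : G →* G} {ρ : Representation ℂ G V}
    (hρ : ρ.IsIrreducible) {S : IntertwiningMap ρ (twist ρ φ)} (hS : S ≠ 0) :
    traceFunction ρ S.toLinearMap ≠ 0 := fun h =>
  hS (IntertwiningMap.ext (hρ.eq_of_traceFunction_eq (h.trans (by
    funext g
    simp [traceFunction]))))

/-- A nonzero intertwining operator from an irreducible finite-dimensional representation to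
its twist is an equivalence. -/
theorem nonempty_equiv_twist_of_ne_zero {φ : G →* G} {ρ : Representation ℂ G V}
    (hρ : ρ.IsIrreducible) {S : IntertwiningMap ρ (twist ρ φ)} (hS : S ≠ 0) :
    Nonempty (ρ.Equiv (twist ρ φ)) := by
  -- Irreducibility of `ρ` alone suffices, although the twist may be reducible: the kernel of `S`
  -- vanishes, and equality of dimensions gives surjectivity.
  have hinj : Function.Injective S := (IsIrreducible.injective_or_eq_zero S).resolve_right hS
  exact ⟨S.ofBijective
    ⟨hinj, (LinearMap.injective_iff_surjective (f := S.toLinearMap)).1 hinj⟩⟩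

theorem ne_zero_and_mem_and_isMatrixCoefficient_iff {φ : G →* G} {ρ : Representation ℂ G V}
    (hρ : ρ.IsIrreducible) (f : G → ℂ) :
    (f ≠ 0 ∧ f ∈ classFunctions φ ∧ IsMatrixCoefficient ρ f) ↔
      ∃ S : IntertwiningMap ρ (twist ρ φ), S ≠ 0 ∧ f = traceFunction ρ S.toLinearMap := by
  constructor
  · rintro ⟨h0, hc, hm⟩
    obtain ⟨S, rfl⟩ := hm.exists_intertwiningMap hρ hc
    refine ⟨S, ?_, rfl⟩
    rintro rfl
    exact h0 (funext fun g => by simp [traceFunction])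
  · rintro ⟨S, hS, rfl⟩
    exact ⟨traceFunction_ne_zero hρ hS, traceFunction_mem_classFunctions S,
      isMatrixCoefficient_traceFunction ρ _⟩

theorem nonempty_equiv_twist_iff {φ : G →* G} {ρ : Representation ℂ G V}
    (hρ : ρ.IsIrreducible) :
    Nonempty (ρ.Equiv (twist ρ φ)) ↔
      ∃ f : G → ℂ, f ≠ 0 ∧ f ∈ classFunctions φ ∧ IsMatrixCoefficient ρ f := by
  simp only [ne_zero_and_mem_and_isMatrixCoefficient_iff hρ]
  constructor
  · rintro ⟨e⟩
    exact ⟨_, e.toIntertwiningMap, ne_zero_of_equiv_twist hρ e, rfl⟩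
  · rintro ⟨_, S, hS, -⟩
    exact nonempty_equiv_twist_of_ne_zero hρ hS

/-- If `S₁` and `S₂` represent the two functions, `S₁⁻¹ S₂` is an endomorphism of `ρ`, hence scalar
by Schur's lemma. -/
theorem exists_eq_smul_of_isMatrixCoefficient {φ : G →* G} {ρ : Representation ℂ G V}
    (hρ : ρ.IsIrreducible) {f₁ f₂ : G → ℂ} (h₁ : f₁ ≠ 0) (hc₁ : f₁ ∈ classFunctions φ)
    (hm₁ : IsMatrixCoefficient ρ f₁) (hc₂ : f₂ ∈ classFunctions φ)
    (hm₂ : IsMatrixCoefficient ρ f₂) : ∃ c : ℂ, f₂ = c • f₁ := by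
  obtain ⟨S₁, hS₁, rfl⟩ :=
    (ne_zero_and_mem_and_isMatrixCoefficient_iff hρ f₁).1 ⟨h₁, hc₁, hm₁⟩
  obtain ⟨S₂, rfl⟩ := hm₂.exists_intertwiningMap hρ hc₂
  obtain ⟨e⟩ := nonempty_equiv_twist_of_ne_zero hρ hS₁
  have hinj : Function.Injective S₁ := (IsIrreducible.injective_or_eq_zero S₁).resolve_right hS₁
  let E : ρ.Equiv (twist ρ φ) := S₁.ofBijective
    ⟨hinj, (LinearMap.injective_iff_surjective (f := S₁.toLinearMap)).1 hinj⟩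
  obtain ⟨c, hc⟩ := (IsIrreducible.algebraMap_intertwiningMap_bijective_of_isAlgClosed
    (ρ := ρ)).2 (E.symm.toIntertwiningMap.comp S₂)
  refine ⟨c, funext fun g => ?_⟩
  have hS : S₂.toLinearMap = c • S₁.toLinearMap := by
    ext x
    have hx : c • x = E.symm (S₂ x) := congrArg (fun f : IntertwiningMap ρ ρ => f x) hc
    have h2 : E (c • x) = S₂ x := by rw [hx]; exact E.toLinearEquiv.apply_symm_apply _
    rw [map_smul] at h2
    exact h2.symm
  simp [traceFunction, hS, LinearMap.smul_comp]

end SingleRepresentation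

/-! ### Linear independence of matrix coefficients -/

section Independence

variable {G : Type u} [Group G] {ι : Type*}
  {V : ι → Type w} [∀ i, AddCommGroup (V i)] [∀ i, Module ℂ (V i)]
  [∀ i, FiniteDimensional ℂ (V i)]

/-- Nonzero matrix coefficients of pairwise inequivalent irreducible finite-dimensional
representations are linearly independent. -/
theorem linearIndependent_of_isMatrixCoefficient (ρ : ∀ i, Representation ℂ G (V i))
    (hirr : ∀ i, (ρ i).IsIrreducible)
    (hne : Pairwise fun i j => IsEmpty ((ρ i).Equiv (ρ j)))
    {T : ι → G → ℂ} (hT : ∀ i, T i ≠ 0) (hm : ∀ i, IsMatrixCoefficient (ρ i) (T i)) :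
    LinearIndependent ℂ T := by
  classical
  choose l hl using hm
  rw [linearIndependent_iff']
  intro s c hc i hi
  obtain ⟨g, hg⟩ := Function.ne_iff.1 (hT i)
  -- This `r` acts as `ρ i g` on the `i`-th representation and as `0` on the others, so evaluating
  -- the relation at `r` leaves `c i • T i g`.
  obtain ⟨r, hr⟩ := exists_asAlgebraHom_eq (fun j : s => ρ j) (fun j => hirr j)
    (fun j k hjk => hne (Subtype.coe_injective.ne hjk))
    (Pi.single ⟨i, hi⟩ (ρ i g))
  have key : ∑ j : s, c j • (l j ∘ₗ (ρ j).asAlgebraHom.toLinearMap) = 0 := by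
    apply MonoidAlgebra.lhom_ext'
    intro x
    ext
    have := congrFun hc x
    rw [← Finset.sum_coe_sort] at this
    simpa [hl] using this
  have h := congrArg (fun f => f r) key
  simp only [LinearMap.sum_apply, LinearMap.smul_apply, LinearMap.comp_apply,
    AlgHom.toLinearMap_apply, hr, LinearMap.zero_apply] at h
  rw [Finset.sum_eq_single ⟨i, hi⟩, Pi.single_eq_same, ← hl] at h
  · exact (smul_eq_zero.1 h).resolve_right hg
  · intro j _ hj
    rw [Pi.single_eq_of_ne hj, map_zero, smul_zero]
  · simp

end Independence

end Reidemeister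

end

section

open Representation MeasureTheory
open scoped InnerProductSpace

namespace Reidemeister

namespace UnitaryIrrep

/-! ### Finite-dimensionality by averaging rank one projections -/

section FiniteDimensional

variable {G : Type u} [Group G] [TopologicalSpace G] (π : UnitaryIrrep.{u, v} G)

/-- The rank one operator `x ↦ ⟪π g v, x⟫ π g v`. -/
noncomputable def orbitProjection (v : π.space) (g : G) : π.space →L[ℂ] π.space :=
  InnerProductSpace.rankOne ℂ (π.action g v) (π.action g v)

theorem orbitProjection_apply (v : π.space) (g : G) (x : π.space) :
    π.orbitProjection v g x = ⟪π.action g v, x⟫_ℂ • π.action g v := rfl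

/-- Strong continuity gives norm continuity here, because a rank one operator depends continuously
on its vector; the Bochner integral in operator norm is thus available. -/
theorem continuous_orbitProjection (v : π.space) : Continuous (π.orbitProjection v) := by
  have := π.continuous_action v
  exact (ContinuousLinearMap.smulRightL ℂ π.space π.space).continuous₂.comp
    (((innerSL ℂ).continuous.comp this).prodMk this)

theorem isCompactOperator_orbitProjection (v : π.space) (g : G) :
    IsCompactOperator (π.orbitProjection v g) := by
  have h : IsCompactOperator (InnerProductSpace.rankOne ℂ (1 : ℂ) (π.action g v)) := by
    refine ⟨Metric.closedBall 0 1, isCompact_closedBall _ _, ?_⟩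
    exact (InnerProductSpace.rankOne ℂ (1 : ℂ) (π.action g v)).continuous.continuousAt
      (by simpa using Metric.closedBall_mem_nhds (0 : ℂ) one_pos)
  have h2 := h.clm_comp (ContinuousLinearMap.toSpanSingleton ℂ (π.action g v))
  have he : ⇑(π.orbitProjection v g) = ContinuousLinearMap.toSpanSingleton ℂ (π.action g v) ∘
      InnerProductSpace.rankOne ℂ (1 : ℂ) (π.action g v) := by
    funext x
    simp [orbitProjection_apply]
  rwa [he]

variable [IsTopologicalGroup G] [CompactSpace G] [MeasurableSpace G] [BorelSpace G]

/-- The average of the rank one operators `orbitProjection` over the group. -/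
noncomputable def averagedProjection (v : π.space) : π.space →L[ℂ] π.space :=
  ∫ g, π.orbitProjection v g ∂(Measure.haar : Measure G)

theorem integrable_orbitProjection (v : π.space) :
    Integrable (π.orbitProjection v) (Measure.haar : Measure G) :=
  (π.continuous_orbitProjection v).integrable_of_hasCompactSupport (.of_compactSpace _)

theorem averagedProjection_apply (v x : π.space) :
    π.averagedProjection v x =
      ∫ g, ⟪π.action g v, x⟫_ℂ • π.action g v ∂(Measure.haar : Measure G) :=
  ContinuousLinearMap.integral_apply (π.integrable_orbitProjection v) x

theorem integrable_inner_smul (v x : π.space) :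
    Integrable (fun g => ⟪π.action g v, x⟫_ℂ • π.action g v) (Measure.haar : Measure G) := by
  have := π.continuous_action v
  exact Continuous.integrable_of_hasCompactSupport (by fun_prop) (.of_compactSpace _)

/-- Compact operators form a closed subspace, which contains averages of its elements; the integral
is a scalar multiple of the average. -/
theorem isCompactOperator_averagedProjection (v : π.space) :
    IsCompactOperator (π.averagedProjection v) := by
  let K : Submodule ℂ (π.space →L[ℂ] π.space) := compactOperator (RingHom.id ℂ) π.space π.space
  have hK : IsClosed (K : Set (π.space →L[ℂ] π.space)) := isClosed_setOfPred_isCompactOperator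
  have h := (K.restrictScalars ℝ).convex.average_mem hK
    (Filter.Eventually.of_forall fun g => π.isCompactOperator_orbitProjection v g)
    (π.integrable_orbitProjection v)
  rw [average_eq] at h
  have hpos : ((Measure.haar : Measure G).real Set.univ)⁻¹ ≠ 0 := by
    rw [ne_eq, inv_eq_zero, measureReal_eq_zero_iff]
    exact isOpen_univ.measure_ne_zero _ Set.univ_nonempty
  exact ((K.restrictScalars ℝ).smul_mem_iff hpos).1 h

theorem inner_averagedProjection (v x y : π.space) :
    ⟪y, π.averagedProjection v x⟫_ℂ =
      ∫ g, ⟪π.action g v, x⟫_ℂ * ⟪y, π.action g v⟫_ℂ ∂(Measure.haar : Measure G) := by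
  rw [averagedProjection_apply, ← integral_inner (π.integrable_inner_smul v x)]
  simp only [inner_smul_right]

theorem isSymmetric_averagedProjection (v : π.space) :
    (π.averagedProjection v).IsSymmetric := by
  intro x y
  change ⟪π.averagedProjection v x, y⟫_ℂ = ⟪x, π.averagedProjection v y⟫_ℂ
  rw [← inner_conj_symm, inner_averagedProjection, inner_averagedProjection, ← integral_conj]
  simp only [map_mul, inner_conj_symm, mul_comm]

theorem averagedProjection_action (v x : π.space) (h : G) :
    π.averagedProjection v (π.action h x) = π.action h (π.averagedProjection v x) := by
  rw [averagedProjection_apply, averagedProjection_apply,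
    ← integral_mul_left_eq_self _ h]
  have := (π.action h).toContinuousLinearEquiv.toContinuousLinearMap.integral_comp_comm
    (π.integrable_inner_smul v x)
  refine Eq.trans ?_ this
  congr 1
  funext g
  simp [map_mul]

/-- `⟪v, A v⟫` is the integral of `‖⟪π g v, v⟫‖ ^ 2`, a continuous nonnegative function that is
positive at `g = 1`. -/
theorem averagedProjection_ne_zero {v : π.space} (hv : v ≠ 0) :
    π.averagedProjection v ≠ 0 := by
  intro h
  have h1 := π.inner_averagedProjection v v v
  have h2 : ∀ g, ⟪π.action g v, v⟫_ℂ * ⟪v, π.action g v⟫_ℂ =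
      ((‖⟪π.action g v, v⟫_ℂ‖ ^ 2 : ℝ) : ℂ) := by
    intro g
    rw [← inner_conj_symm v (π.action g v), Complex.mul_conj, Complex.normSq_eq_norm_sq]
  simp only [h2, h, _root_.zero_apply, inner_zero_right] at h1
  rw [integral_complex_ofReal, eq_comm, Complex.ofReal_eq_zero] at h1
  have hc := π.continuous_action v
  refine (Continuous.integral_pos_of_hasCompactSupport_nonneg_nonzero
    (μ := (Measure.haar : Measure G)) (f := fun g => ‖⟪π.action g v, v⟫_ℂ‖ ^ 2) (x := 1)
    (by fun_prop) (.of_compactSpace _) (fun g => by positivity) ?_).ne' h1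
  simpa using hv

end FiniteDimensional

/-! ### Consequences for unitary representations: irreducibility, equivalence, continuity -/

variable {G : Type u} [Group G] [TopologicalSpace G]

/-- Irreducible unitary representations of compact groups are finite-dimensional. -/
theorem finiteDimensional [IsTopologicalGroup G] [CompactSpace G] (π : UnitaryIrrep.{u, v} G) :
    FiniteDimensional ℂ π.space := by
  borelize G
  have := π.nontrivial
  obtain ⟨v, hv⟩ := exists_ne (0 : π.space)
  have hA := π.averagedProjection_ne_zero hv
  have hcomp := π.isCompactOperator_averagedProjection v
  -- A nonzero compact symmetric operator has a nonzero eigenvalue. Its eigenspace is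
  -- finite-dimensional and invariant, hence the whole space.
  rw [ne_eq, ← ContinuousLinearMap.eq_zero_of_forall_hasEigenvalue_eq_zero hcomp
    (π.isSymmetric_averagedProjection v)] at hA
  push Not at hA
  obtain ⟨μ, hμ, hμ0⟩ := hA
  have hfin := ContinuousLinearMap.finite_dimensional_eigenspace hcomp μ hμ0
  rcases π.irreducible (Module.End.eigenspace (π.averagedProjection v).toLinearMap μ)
    (Submodule.closed_of_finiteDimensional _) (fun g x hx => by
      rw [Module.End.mem_eigenspace_iff] at hx ⊢
      change π.averagedProjection v x = μ • x at hx
      change π.averagedProjection v (π.action g x) = μ • π.action g x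
      rw [averagedProjection_action, hx, map_smul]) with h | h
  · exact absurd h hμ
  · rw [h] at hfin
    exact Submodule.topEquiv.finiteDimensional

theorem isIrreducible_toRepresentation (π : UnitaryIrrep.{u, v} G) [FiniteDimensional ℂ π.space] :
    π.toRepresentation.IsIrreducible := by
  have := π.nontrivial
  refine { exists_pair_ne := ⟨⊥, ⊤, fun h => ?_⟩, eq_bot_or_eq_top := fun K => ?_ }
  · have h' : (⊥ : Submodule ℂ π.space) = ⊤ := congrArg Subrepresentation.toSubmodule h
    exact bot_ne_top h'
  · rcases π.irreducible K.toSubmodule (Submodule.closed_of_finiteDimensional _)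
      (fun g x hx => K.apply_mem_toSubmodule g hx) with h | h
    · exact Or.inl (Subrepresentation.toSubmodule_injective h)
    · exact Or.inr (Subrepresentation.toSubmodule_injective h)

/-- Linearly equivalent finite-dimensional irreducible unitary representations are unitarily
equivalent. -/
theorem toDual_eq_of_equiv {π σ : UnitaryIrrep.{u, v} G} [FiniteDimensional ℂ π.space]
    [FiniteDimensional ℂ σ.space] (e : π.toRepresentation.Equiv σ.toRepresentation) :
    π.toDual = σ.toDual := by
  have hirr := π.isIrreducible_toRepresentation
  have he : ∀ g x, e (π.action g x) = σ.action g (e x) := fun g x =>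
    e.toIntertwiningMap.isIntertwining _ _ g x
  let L : π.space →ₗ[ℂ] σ.space := e.toLinearEquiv.toLinearMap
  have hL : ∀ x, L x = e x := fun _ => rfl
  -- `L* L` commutes with `π`, so it is a scalar `c`, and `e` multiplies all norms by one factor
  -- `t`; then `t⁻¹ e` is unitary.
  let B : IntertwiningMap π.toRepresentation π.toRepresentation :=
    ⟨LinearMap.adjoint L ∘ₗ L, fun g => by
      ext x
      refine ext_inner_right ℂ fun y => ?_
      have hy : y = π.action g (π.action g⁻¹ y) := by
        rw [map_inv]
        exact ((π.action g).apply_symm_apply y).symm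
      change ⟪LinearMap.adjoint L (L (π.action g x)), y⟫_ℂ =
        ⟪π.action g (LinearMap.adjoint L (L x)), y⟫_ℂ
      rw [LinearMap.adjoint_inner_left, hy, LinearIsometryEquiv.inner_map_map,
        LinearMap.adjoint_inner_left, hL, hL, hL, hL, he, he, LinearIsometryEquiv.inner_map_map]⟩
  obtain ⟨c, hc⟩ := (IsIrreducible.algebraMap_intertwiningMap_bijective_of_isAlgClosed
    (ρ := π.toRepresentation)).2 B
  have hB : ∀ x, c • x = LinearMap.adjoint L (L x) := fun x =>
    congrArg (fun f : IntertwiningMap π.toRepresentation π.toRepresentation => f x) hc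
  have hinner : ∀ x y, ⟪e x, e y⟫_ℂ = c * ⟪x, y⟫_ℂ := by
    intro x y
    rw [← hL, ← hL, ← LinearMap.adjoint_inner_right, ← hB, inner_smul_right]
  have := π.nontrivial
  obtain ⟨v, hv⟩ := exists_ne (0 : π.space)
  have hev : e v ≠ 0 := fun h => hv (e.toLinearEquiv.injective (h.trans (map_zero _).symm))
  let t : ℝ := ‖e v‖ / ‖v‖
  have ht : 0 < t := div_pos (norm_pos_iff.2 hev) (norm_pos_iff.2 hv)
  have hnorm : ∀ x, ‖e x‖ = t * ‖x‖ := by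
    have hcx : ∀ x, ‖e x‖ ^ 2 = ‖c‖ * ‖x‖ ^ 2 := by
      intro x
      have := congrArg Norm.norm (hinner x x)
      rwa [inner_self_eq_norm_sq_to_K, norm_mul, inner_self_eq_norm_sq_to_K, norm_pow, norm_pow,
        RCLike.norm_ofReal, RCLike.norm_ofReal, abs_norm, abs_norm] at this
    have hct : ‖c‖ = t ^ 2 := by
      have := hcx v
      have hv' := norm_ne_zero_iff.2 hv
      simp only [t]
      field_simp
      linarith
    intro x
    rw [← sq_eq_sq₀ (norm_nonneg _) (by positivity), hcx, hct, mul_pow]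
  have ht' : (t : ℂ)⁻¹ ≠ 0 := by
    simpa using ht.ne'
  let U : π.space ≃ₗᵢ[ℂ] σ.space :=
    { e.toLinearEquiv.trans (LinearEquiv.smulOfNeZero ℂ σ.space (t : ℂ)⁻¹ ht') with
      norm_map' := fun x => by
        change ‖(t : ℂ)⁻¹ • e x‖ = ‖x‖
        rw [norm_smul, hnorm, norm_inv, Complex.norm_real, Real.norm_of_nonneg ht.le]
        field_simp }
  refine Quotient.sound ⟨U, fun g x => ?_⟩
  change (t : ℂ)⁻¹ • e (π.action g x) = σ.action g ((t : ℂ)⁻¹ • e x)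
  rw [he, map_smul]

theorem IsFixed.nonempty_equiv {π : UnitaryIrrep.{u, v} G} {φ : G →* G} (h : π.IsFixed φ) :
    Nonempty (π.toRepresentation.Equiv (twist π.toRepresentation φ)) := by
  obtain ⟨U, hU⟩ := h
  exact ⟨Representation.Equiv.mk U.toLinearEquiv fun g => LinearMap.ext (hU g)⟩

/-- Matrix coefficients of finite-dimensional unitary representations are continuous. -/
theorem continuous_of_isMatrixCoefficient (π : UnitaryIrrep.{u, v} G)
    [FiniteDimensional ℂ π.space] {f : G → ℂ} (hf : IsMatrixCoefficient π.toRepresentation f) :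
    Continuous f := by
  obtain ⟨l, hl⟩ := hf
  let b := Module.finBasis ℂ π.space
  -- Expanding `π g` over the basis reduces continuity to that of the orbits of the basis vectors.
  have h : f = fun g => ∑ i, (l ∘ₗ LinearMap.smulRightₗ (b.coord i)) (π.action g (b i)) := by
    funext g
    rw [hl]
    simp only [LinearMap.comp_apply]
    rw [← map_sum]
    congr 1
    refine b.ext fun j => ?_
    simp [LinearMap.sum_apply, Finsupp.single_apply, toRepresentation]
  rw [h]
  refine continuous_finsetSum _ fun i _ => ?_
  exact (LinearMap.continuous_of_finiteDimensional _).comp (π.continuous_action (b i))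

end UnitaryIrrep

end Reidemeister

end

section

open Representation

namespace Reidemeister

/-! ### Class functions and the Reidemeister number -/

section ClassFunctions

variable {G : Type u} [Group G] (φ : G →* G)

/-- Class functions are the functions on the set of Reidemeister classes. -/
def classFunctionsEquiv : (Quotient (twistedConj φ) → ℂ) ≃ₗ[ℂ] classFunctions φ where
  toFun F := ⟨fun g => F (Quotient.mk _ g), fun _ _ h => congrArg F (Quotient.sound h)⟩
  map_add' _ _ := rfl
  map_smul' _ _ := rfl
  invFun f := Quotient.lift f.1 f.2
  left_inv F := by
    funext q
    induction q using Quotient.inductionOn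
    rfl
  right_inv _ := rfl

variable {φ}

/-- Indicators of arbitrary sets of classes are class functions; their continuity makes the quotient
discrete, and it is compact. -/
theorem finite_quotient_of_continuous [TopologicalSpace G] [CompactSpace G]
    (h : ∀ f ∈ classFunctions φ, Continuous f) : Finite (Quotient (twistedConj φ)) := by
  classical
  have : DiscreteTopology (Quotient (twistedConj φ)) := by
    refine discreteTopology_iff_forall_isOpen.2 fun s => ?_
    let f := classFunctionsEquiv φ (s.indicator 1)
    have hopen : IsOpen (f.1 ⁻¹' {0}ᶜ) := isOpen_compl_singleton.preimage (h _ f.2)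
    have hs : f.1 ⁻¹' {0}ᶜ = Quotient.mk (twistedConj φ) ⁻¹' s := by
      ext g
      change s.indicator (1 : Quotient (twistedConj φ) → ℂ) (Quotient.mk _ g) ≠ 0 ↔ Quotient.mk _ g ∈ s
      simp
    rw [hs] at hopen
    exact hopen
  exact finite_of_compact_of_discrete

theorem finiteDimensional_classFunctions [Finite (Quotient (twistedConj φ))] :
    FiniteDimensional ℂ (classFunctions φ) :=
  (classFunctionsEquiv φ).finiteDimensional

theorem natCast_finrank_classFunctions [Finite (Quotient (twistedConj φ))] :
    (Module.finrank ℂ (classFunctions φ) : ℕ∞) = reidemeisterNumber φ := by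
  have := Fintype.ofFinite (Quotient (twistedConj φ))
  rw [← (classFunctionsEquiv φ).finrank_eq, Module.finrank_fintype_fun_eq_card,
    reidemeisterNumber, ENat.card_eq_coe_fintype_card]

end ClassFunctions

/-! ### Coefficient systems and the twisted Burnside–Frobenius theorem -/

section CoefficientSystems

variable {G : Type u} [Group G] [TopologicalSpace G] {φ : G →* G}
  {T : FixedPoint.{u, v} φ → G → ℂ}

theorem IsCoefficientSystem.span_le (hT : IsCoefficientSystem φ T) :
    Submodule.span ℂ (Set.range T) ≤ classFunctions φ :=
  Submodule.span_le.2 (Set.range_subset_iff.2 fun p => (hT p).2.1)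

variable [IsTopologicalGroup G] [CompactSpace G]

theorem exists_isCoefficientSystem (φ : G →* G) :
    ∃ T : FixedPoint.{u, v} φ → G → ℂ, IsCoefficientSystem φ T := by
  have key : ∀ p : FixedPoint.{u, v} φ, ∃ f : G → ℂ, f ≠ 0 ∧ f ∈ classFunctions φ ∧
      ∃ π : UnitaryIrrep.{u, v} G, π.toDual = p.1 ∧
        IsMatrixCoefficient π.toRepresentation f := by
    rintro ⟨p, π, hπ, hfix⟩
    have := π.finiteDimensional
    obtain ⟨f, h0, hc, hm⟩ :=
      (nonempty_equiv_twist_iff π.isIrreducible_toRepresentation).1 hfix.nonempty_equiv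
    exact ⟨f, h0, hc, π, hπ, hm⟩
  choose T hT using key
  exact ⟨T, hT⟩

theorem IsCoefficientSystem.linearIndependent (hT : IsCoefficientSystem φ T) :
    LinearIndependent ℂ T := by
  choose h0 hc π hπ hm using hT
  have hfin : ∀ p, FiniteDimensional ℂ (π p).space := fun p => (π p).finiteDimensional
  refine linearIndependent_of_isMatrixCoefficient (fun p => (π p).toRepresentation)
    (fun p => (π p).isIrreducible_toRepresentation) (fun p q hpq => ⟨fun e => hpq ?_⟩) h0 hm
  exact Subtype.ext ((hπ p).symm.trans ((UnitaryIrrep.toDual_eq_of_equiv e).trans (hπ q)))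

theorem IsCoefficientSystem.continuous_of_mem_span (hT : IsCoefficientSystem φ T) {f : G → ℂ}
    (hf : f ∈ Submodule.span ℂ (Set.range T)) : Continuous f := by
  induction hf using Submodule.span_induction with
  | mem f hf =>
    obtain ⟨p, rfl⟩ := hf
    obtain ⟨-, -, π, -, hm⟩ := hT p
    have := π.finiteDimensional
    exact π.continuous_of_isMatrixCoefficient hm
  | zero => exact continuous_zero
  | add _ _ _ _ h₁ h₂ => exact h₁.add h₂
  | smul c _ _ h => exact h.const_smul c

theorem IsCoefficientSystem.finite_and_tbft_iff (hT : IsCoefficientSystem φ T) :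
    ((reidemeisterNumber φ < ⊤ ∨ fixedPointNumber.{u, v} φ < ⊤) ∧ TBFT.{u, v} φ) ↔
      (LinearIndependent ℂ T ∧ Submodule.span ℂ (Set.range T) = classFunctions φ) := by
  have hli := hT.linearIndependent
  constructor
  · rintro ⟨hfin, htbft⟩
    have heq := htbft hfin
    -- Finiteness of either number passes to both through their equality.
    rw [← heq, or_self] at hfin
    have hR : Finite (Quotient (twistedConj φ)) := ENat.card_lt_top.1 hfin
    rw [heq] at hfin
    have hF : Finite (FixedPoint.{u, v} φ) := ENat.card_lt_top.1 hfin
    have := Fintype.ofFinite (FixedPoint.{u, v} φ)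
    have := finiteDimensional_classFunctions (φ := φ)
    refine ⟨hli, Submodule.eq_of_le_of_finrank_eq hT.span_le ?_⟩
    rw [finrank_span_eq_card hli, ← Nat.cast_inj (R := ℕ∞), natCast_finrank_classFunctions, heq,
      fixedPointNumber, ENat.card_eq_coe_fintype_card]
  · rintro ⟨-, hspan⟩
    have hR : Finite (Quotient (twistedConj φ)) :=
      finite_quotient_of_continuous fun f hf => hT.continuous_of_mem_span (hspan ▸ hf)
    refine ⟨Or.inl (ENat.card_lt_top.2 hR), fun _ => ?_⟩
    have := finiteDimensional_classFunctions (φ := φ)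
    rw [← hspan] at this
    -- A basis of the now finite-dimensional space of class functions is indexed by the fixed
    -- points, so these are finite in number.
    have b := Module.Basis.span hli
    have := Module.Finite.finite_basis b
    have := Fintype.ofFinite (FixedPoint.{u, v} φ)
    rw [← natCast_finrank_classFunctions, ← hspan, finrank_span_eq_card hli, fixedPointNumber,
      ENat.card_eq_coe_fintype_card]

end CoefficientSystems

end Reidemeister

end

theorem mainTheorem9 {G : Type u} [Group G] [TopologicalSpace G]
    [IsTopologicalGroup G] [CompactSpace G] [T2Space G] (φ : G →* G) :
    -- a single finite-dimensional irreducible representation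
    (∀ (V : Type w) [NormedAddCommGroup V] [NormedSpace ℂ V] [FiniteDimensional ℂ V]
        (ρ : Representation ℂ G V), (∀ x : V, Continuous fun g => ρ g x) → ρ.IsIrreducible →
      (Nonempty (ρ.Equiv (Reidemeister.twist ρ φ)) ↔
        ∃ f : G → ℂ, f ≠ 0 ∧ f ∈ Reidemeister.classFunctions φ ∧
          Reidemeister.IsMatrixCoefficient ρ f) ∧
      (Nonempty (ρ.Equiv (Reidemeister.twist ρ φ)) →
        (∀ f₁ f₂ : G → ℂ,
          f₁ ≠ 0 → f₁ ∈ Reidemeister.classFunctions φ → Reidemeister.IsMatrixCoefficient ρ f₁ →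
          f₂ ∈ Reidemeister.classFunctions φ → Reidemeister.IsMatrixCoefficient ρ f₂ →
          ∃ c : ℂ, f₂ = c • f₁) ∧
        (∀ f : G → ℂ,
          (f ≠ 0 ∧ f ∈ Reidemeister.classFunctions φ ∧ Reidemeister.IsMatrixCoefficient ρ f) ↔
          ∃ S : Representation.IntertwiningMap ρ (Reidemeister.twist ρ φ),
            S ≠ 0 ∧ f = Reidemeister.traceFunction ρ S.toLinearMap))) ∧
    -- the twisted Burnside–Frobenius theorem
    (∃ T : Reidemeister.FixedPoint.{u, v} φ → G → ℂ, Reidemeister.IsCoefficientSystem φ T) ∧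
    (∀ T : Reidemeister.FixedPoint.{u, v} φ → G → ℂ, Reidemeister.IsCoefficientSystem φ T →
      (((Reidemeister.reidemeisterNumber φ < ⊤ ∨ Reidemeister.fixedPointNumber.{u, v} φ < ⊤) ∧
          Reidemeister.TBFT.{u, v} φ) ↔
        (LinearIndependent ℂ T ∧
          Submodule.span ℂ (Set.range T) = Reidemeister.classFunctions φ))) := by
  refine ⟨fun V _ _ _ ρ _ hρ => ⟨Reidemeister.nonempty_equiv_twist_iff hρ, fun _ =>
    ⟨fun f₁ f₂ h₁ hc₁ hm₁ hc₂ hm₂ =>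
      Reidemeister.exists_eq_smul_of_isMatrixCoefficient hρ h₁ hc₁ hm₁ hc₂ hm₂,
    Reidemeister.ne_zero_and_mem_and_isMatrixCoefficient_iff hρ⟩⟩,
    Reidemeister.exists_isCoefficientSystem φ, fun T hT => hT.finite_and_tbft_iff⟩
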